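/- Let $d\ge 1$. Let $u$ be a weight on $\mathbb R^d$, that is, a nonnegative locally integrable function, and let $w$ be a weight on $(0,\infty)$, that is, a nonnegative function integrable on $(0,r]$ for every $r>0$. For a measurable set $E\subset\mathbb R^d$ let $|E|$ be its Lebesgue measure and $u(E)=\int_E u(x)\,dx$, and let $W(t)=\int_0^t w(s)\,ds$ for $0\le t\le\infty$. Assume that $w$ satisfies the $\Delta_2$ condition: there is a finite constant $c$ with $W(2r)\le c\,W(r)$ for every $r>0$. For $p>0$ and a Lebesgue measurable function $f$ on $\mathbb R^d$ put $$\|f\|_{\Lambda^p_u(w)}=\Big(\int_0^\infty p\,t^{p-1}\,W\big(u(\{x:|f(x)|>t\})\big)\,dt\Big)^{1/p},\qquad \|f\|_{\Lambda^{p,\infty}_u(w)}=\sup_{t>0}\,t\,W\big(u(\{x:|f(x)|>t\})\big)^{1/p},$$ and let $\Lambda^p_u(w)$ and $\Lambda^{p,\infty}_u(w)$ be the classes of measurable $f$ for which the respective quantity is finite. Let $Mf(x)=\sup_{Q\ni x}\frac1{|Q|}\int_Q|f(y)|\,dy$ be the Hardy--Littlewood maximal operator, the supremum being over all cubes $Q$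 (with sides parallel to the axes) containing $x$. An operator $M:X\to Y$ between two such classes is called bounded if there is a finite constant $C$ such that $Mf\in Y$ and $\|Mf\|_Y\le C\|f\|_X$ for every $f\in X$. Let $p>1$. Then $M:\Lambda^p_u(w)\to\Lambda^{p,\infty}_u(w)$ is bounded if and only if there exist $q\in(0,p)$ and a constant $C>0$ such that, for every finite family of cubes $(Q_j)_{j=1}^J$ and every family of measurable sets $(S_j)_{j=1}^J$ with $S_j\subset Q_j$ for every $j$, $$\frac{W\big(u\big(\bigcup_{j=1}^J Q_j\big)\big)}{W\big(u\big(\bigcup_{j=1}^J S_j\big)\big)}\le C\max_{1\le j\le J}\Big(\frac{|Q_j|}{|S_j|}\Big)^q .$$ (Quotients are taken in $[0,\infty]$, with $a/0=\infty$ for $a>0$ and $0/0=0$.) In particular, $$M:\Lambda^p_u(w)\to\Lambda^{p,\infty}_u(w)\ \text{is bounded}\iff M:\Lambda^p_u(w)\to\Lambda^p_u(w)\ \text{is bounded}.$$ -/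

import Mathlib

open MeasureTheory Set
open scoped ENNReal NNReal

noncomputable section

namespace WeightedLorentz

/-- A weight on `ℝ^d`: a nonnegative locally integrable function. -/
structure IsWeight {d : ℕ} (u : (Fin d → ℝ) → ℝ) : Prop where
  nonneg : ∀ x, 0 ≤ u x
  locallyIntegrable : LocallyIntegrable u volume

/-- A weight on `(0, ∞)`: a nonnegative function there, integrable on every `(0, r]`.
The values of `w` on `(-∞, 0]` play no role. -/
structure IsHalfLineWeight (w : ℝ → ℝ) : Prop where
  nonneg : ∀ s, 0 < s → 0 ≤ w s
  integrableOn : ∀ r, 0 < r → IntegrableOn w (Ioc 0 r) volume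

/-- `u(E) = ∫_E u(x) dx`, with values in `[0, ∞]`. -/
def weightOf {d : ℕ} (u : (Fin d → ℝ) → ℝ) (E : Set (Fin d → ℝ)) : ℝ≥0∞ :=
  ∫⁻ x in E, ENNReal.ofReal (u x)

/-- `W(t) = ∫_0^t w(s) ds` for `t ∈ [0, ∞]`. -/
def primitive (w : ℝ → ℝ) (t : ℝ≥0∞) : ℝ≥0∞ :=
  ∫⁻ s in {s : ℝ | 0 < s ∧ ENNReal.ofReal s < t}, ENNReal.ofReal (w s)

/-- The condition `Δ₂`: `W(2r) ≤ C W(r)` for all `r > 0`. -/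
def DeltaTwo (w : ℝ → ℝ) : Prop :=
  ∃ C : ℝ≥0, ∀ r : ℝ, 0 < r →
    primitive w (ENNReal.ofReal (2 * r)) ≤ C * primitive w (ENNReal.ofReal r)

/-- Nondegenerate (open) cubes of `ℝ^d` with sides parallel to the axes. -/
def IsCube {d : ℕ} (Q : Set (Fin d → ℝ)) : Prop :=
  ∃ (a : Fin d → ℝ) (l : ℝ), 0 < l ∧ Q = Set.pi univ fun i => Ioo (a i) (a i + l)

/-- The (uncentred) Hardy–Littlewood maximal function, with values in `[0, ∞]`. -/
def maximal {d : ℕ} (f : (Fin d → ℝ) → ℝ) (x : Fin d → ℝ) : ℝ≥0∞ :=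
  ⨆ (Q : Set (Fin d → ℝ)) (_ : IsCube Q) (_ : x ∈ Q), (∫⁻ y in Q, ‖f y‖ₑ) / volume Q

/-- `u({x : |f(x)| > t})`. It is defined for functions with values in any space with a
`[0, ∞]`-valued norm, so that it applies both to real-valued functions and to `maximal f`. -/
def distribution {d : ℕ} {ε : Type*} [ENorm ε] (u : (Fin d → ℝ) → ℝ)
    (f : (Fin d → ℝ) → ε) (t : ℝ) : ℝ≥0∞ :=
  weightOf u {x | ENNReal.ofReal t < ‖f x‖ₑ}

/-- `‖f‖_{Λ^p_u(w)} = (∫_0^∞ p t^{p-1} W(u({|f| > t})) dt)^{1/p}`. -/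
def lorentzNorm {d : ℕ} {ε : Type*} [ENorm ε] (p : ℝ) (u : (Fin d → ℝ) → ℝ) (w : ℝ → ℝ)
    (f : (Fin d → ℝ) → ε) : ℝ≥0∞ :=
  (∫⁻ t in Ioi (0 : ℝ),
    ENNReal.ofReal (p * t ^ (p - 1)) * primitive w (distribution u f t)) ^ (1 / p)

/-- `‖f‖_{Λ^{p,∞}_u(w)} = sup_{t > 0} t W(u({|f| > t}))^{1/p}`. -/
def weakLorentzNorm {d : ℕ} {ε : Type*} [ENorm ε] (p : ℝ) (u : (Fin d → ℝ) → ℝ) (w : ℝ → ℝ)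
    (f : (Fin d → ℝ) → ε) : ℝ≥0∞ :=
  ⨆ (t : ℝ) (_ : 0 < t), ENNReal.ofReal t * primitive w (distribution u f t) ^ (1 / p)

/-- Membership in `Λ^p_u(w)`. (`AEMeasurable f volume` is Lebesgue measurability.) -/
def MemLorentz {d : ℕ} {ε : Type*} [ENorm ε] [MeasurableSpace ε] (p : ℝ)
    (u : (Fin d → ℝ) → ℝ) (w : ℝ → ℝ) (f : (Fin d → ℝ) → ε) : Prop :=
  AEMeasurable f volume ∧ lorentzNorm p u w f < ∞

/-- Membership in `Λ^{p,∞}_u(w)`. -/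
def MemWeakLorentz {d : ℕ} {ε : Type*} [ENorm ε] [MeasurableSpace ε] (p : ℝ)
    (u : (Fin d → ℝ) → ℝ) (w : ℝ → ℝ) (f : (Fin d → ℝ) → ε) : Prop :=
  AEMeasurable f volume ∧ weakLorentzNorm p u w f < ∞

/-- `M : Λ^p_u(w) → Λ^p_u(w)` is bounded. -/
def StrongTypeBounded {d : ℕ} (p : ℝ) (u : (Fin d → ℝ) → ℝ) (w : ℝ → ℝ) : Prop :=
  ∃ C : ℝ≥0, ∀ f : (Fin d → ℝ) → ℝ, MemLorentz p u w f →
    MemLorentz p u w (maximal f) ∧ lorentzNorm p u w (maximal f) ≤ C * lorentzNorm p u w f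

/-- `M : Λ^p_u(w) → Λ^{p,∞}_u(w)` is bounded. -/
def WeakTypeBounded {d : ℕ} (p : ℝ) (u : (Fin d → ℝ) → ℝ) (w : ℝ → ℝ) : Prop :=
  ∃ C : ℝ≥0, ∀ f : (Fin d → ℝ) → ℝ, MemLorentz p u w f →
    MemWeakLorentz p u w (maximal f) ∧
      weakLorentzNorm p u w (maximal f) ≤ C * lorentzNorm p u w f

/-- The geometric condition: for some `q ∈ (0, p)` and `C > 0`,
`W(u(⋃ Q_j)) / W(u(⋃ S_j)) ≤ C max_j (|Q_j| / |S_j|)^q` for all finite families of cubes `Q_j`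
and Lebesgue measurable sets `S_j ⊆ Q_j`. Both quotients are taken in `[0, ∞]`, where `a / 0 = ∞`
for `a ≠ 0` and `0 / 0 = 0`; so nothing is claimed if some `S_j` is a null set. -/
def GeometricCondition {d : ℕ} (p : ℝ) (u : (Fin d → ℝ) → ℝ) (w : ℝ → ℝ) : Prop :=
  ∃ q : ℝ, 0 < q ∧ q < p ∧ ∃ C : ℝ≥0, 0 < C ∧
    ∀ (J : ℕ) (Q S : Fin J → Set (Fin d → ℝ)),
      (∀ j, IsCube (Q j)) → (∀ j, NullMeasurableSet (S j) volume) → (∀ j, S j ⊆ Q j) →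
        primitive w (weightOf u (⋃ j, Q j)) / primitive w (weightOf u (⋃ j, S j)) ≤
          C * ⨆ j, (volume (Q j) / volume (S j)) ^ q

end WeightedLorentz

end

noncomputable section

namespace WeightedLorentz

variable {d : ℕ} {u : (Fin d → ℝ) → ℝ} {w : ℝ → ℝ} {p : ℝ}

/-! Write `M1_E` for the maximal function of the characteristic function of `E`. The geometric
condition is equivalent, up to constants, to the power estimate `W(u{M1_E > s}) ≤ C s^(-q) W(u(E))`
for `0 < s ≤ 1`, with some `q < p`: cover `{M1_E > s}` by cubes `Q` and take `S = E ∩ Q`, or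
conversely take `E = ⋃ S_j`.

Power estimate to strong type: cut `f` at the heights `a^k t`. If `Mf > (1 + 2a)t` at a point, then
there `M1_{|f| > a^k t} > (2a)^(-k)` for some `k`. The condition `Δ₂` gives `W(∑ b_k) ≤ c ∑ c^k
W(b_k)`, and integration in `t` turns the `k`-th term into `(c (2a)^q a^(-p))^k` times the integral
of `f`. Since `q < p`, a large `a` makes the series converge
(`GeometricCondition.exists_lorentzIntegral_maximal_le`).

Weak type to power estimate: testing on `1_E` yields only the exponent `p`. Testing instead on
`M1_E` restricted to `{M1_E > δ}` gains a logarithm. The `p`-th power of its norm is `O(log(1/δ))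
W(u(E))`, while its average over every cube with `|E ∩ Q| > δ|Q|` is at least `6^(-d) δ log(1/δ)`.
This improves `δ^(-p)` by a factor of order `log(1/δ)^(1-p)`, which is small as `p > 1`
(`primitive_superlevel_le_log`). For one small `δ` the constant thus falls strictly below `(6^d
δ)^(-p)`, hence below `(6^d δ)^(-q)` for some `q < p`. The inclusion `{M1_E > 6^d s t} ⊆ {M1_{M1_E >
s} > t}` (`superlevel_mul_subset`) lets this single estimate be iterated to all scales. -/

/-! ### The primitive `W` and the condition `Δ₂`. -/

theorem primitive_mono : Monotone (primitive w) := fun _ _ h =>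
  lintegral_mono_set fun _ hs => ⟨hs.1, hs.2.trans_le h⟩

@[simp]
theorem primitive_zero : primitive w 0 = 0 := by
  simp [primitive]

/-- Left continuity of `W`, due to the strict inequality in its domain of integration. It reduces
countable families of cubes to finite ones and sums to suprema. -/
theorem primitive_iSup {ι : Type*} [Countable ι] (b : ι → ℝ≥0∞) :
    primitive w (⨆ i, b i) = ⨆ i, primitive w (b i) := by
  have h : {s : ℝ | 0 < s ∧ ENNReal.ofReal s < ⨆ i, b i} =
      ⋃ i, {s : ℝ | 0 < s ∧ ENNReal.ofReal s < b i} := by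
    ext s
    simp [lt_iSup_iff]
  unfold primitive
  rw [h, setLIntegral_iUnion_of_directed]
  intro i j
  rcases le_total (b i) (b j) with hij | hij
  · exact ⟨j, fun s hs => ⟨hs.1, hs.2.trans_le hij⟩, subset_rfl⟩
  · exact ⟨i, subset_rfl, fun s hs => ⟨hs.1, hs.2.trans_le hij⟩⟩

theorem DeltaTwo.exists_primitive_two_mul_le (h : DeltaTwo w) :
    ∃ c : ℝ≥0, ∀ t : ℝ≥0∞, primitive w (2 * t) ≤ c * primitive w t := by
  obtain ⟨C, hC⟩ := h
  refine ⟨max C 1, fun t => ?_⟩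
  rcases eq_or_ne t 0 with rfl | h0
  · simp
  -- At `t = ∞` both sides involve `W(∞)`, so the constant must be at least 1.
  rcases eq_or_ne t ∞ with rfl | ht
  · rw [ENNReal.mul_top two_ne_zero]
    exact le_mul_of_one_le_left' (by exact_mod_cast le_max_right C 1)
  have := hC t.toReal (ENNReal.toReal_pos h0 ht)
  rw [ENNReal.ofReal_mul zero_le_two, ENNReal.ofReal_toReal ht, ENNReal.ofReal_ofNat] at this
  refine this.trans ?_
  gcongr
  exact le_max_left _ _

theorem primitive_two_pow_mul_le {c : ℝ≥0}
    (hc : ∀ t : ℝ≥0∞, primitive w (2 * t) ≤ c * primitive w t) (k : ℕ) (t : ℝ≥0∞) :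
    primitive w (2 ^ k * t) ≤ c ^ k * primitive w t := by
  induction k with
  | zero => simp
  | succ k ih =>
    rw [pow_succ', mul_assoc, pow_succ', mul_assoc]
    exact (hc _).trans (by gcongr)

/-- A quantitative substitute for countable subadditivity of `W`. -/
theorem primitive_tsum_le {c : ℝ≥0}
    (hc : ∀ t : ℝ≥0∞, primitive w (2 * t) ≤ c * primitive w t) (b : ℕ → ℝ≥0∞) :
    primitive w (∑' k, b k) ≤ c * ∑' k, (c : ℝ≥0∞) ^ k * primitive w (b k) := by
  -- A sum is controlled by a supremum with geometric weights; `W` commutes with the supremum, and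
  -- each doubling costs one factor `c`.
  have hsum : ∑' k, b k ≤ 2 * ⨆ k, 2 ^ k * b k := by
    have hb : ∀ k, b k ≤ (2⁻¹ : ℝ≥0∞) ^ k * ⨆ k, 2 ^ k * b k := fun k => by
      calc b k = (2⁻¹ : ℝ≥0∞) ^ k * (2 ^ k * b k) := by
            rw [← mul_assoc, ← mul_pow, ENNReal.inv_mul_cancel two_ne_zero ENNReal.ofNat_ne_top]
            simp
        _ ≤ _ := by
            gcongr
            exact le_iSup (fun k => 2 ^ k * b k) k
    refine (ENNReal.tsum_le_tsum hb).trans ?_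
    rw [ENNReal.tsum_mul_right, ENNReal.tsum_geometric, ENNReal.one_sub_inv_two, inv_inv]
  refine (primitive_mono hsum).trans ((hc _).trans ?_)
  gcongr
  rw [primitive_iSup]
  exact iSup_le fun k => (primitive_two_pow_mul_le hc k _).trans
    (ENNReal.le_tsum (f := fun k => (c : ℝ≥0∞) ^ k * primitive w (b k)) k)

/-! ### Distribution functions, cubes and level sets of the maximal function. -/

theorem weightOf_mono {E F : Set (Fin d → ℝ)} (h : E ⊆ F) : weightOf u E ≤ weightOf u F :=
  lintegral_mono_set h

theorem distribution_antitone {ε : Type*} [ENorm ε] (f : (Fin d → ℝ) → ε) :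
    Antitone (distribution u f) := fun _ _ h =>
  weightOf_mono fun _ hx => (ENNReal.ofReal_le_ofReal h).trans_lt hx

theorem measurable_primitive_distribution {ε : Type*} [ENorm ε] (f : (Fin d → ℝ) → ε) :
    Measurable fun t => primitive w (distribution u f t) :=
  (primitive_mono.comp_antitone (distribution_antitone f)).measurable

theorem IsCube.isOpen {Q : Set (Fin d → ℝ)} (h : IsCube Q) : IsOpen Q := by
  obtain ⟨a, l, -, rfl⟩ := h
  exact isOpen_set_pi finite_univ fun i _ => isOpen_Ioo

theorem IsCube.volume_ne_zero {Q : Set (Fin d → ℝ)} (h : IsCube Q) : volume Q ≠ 0 := by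
  obtain ⟨a, l, hl, rfl⟩ := h
  simp [Real.volume_pi_Ioo, hl]

theorem IsCube.volume_ne_top {Q : Set (Fin d → ℝ)} (h : IsCube Q) : volume Q ≠ ∞ := by
  obtain ⟨a, l, hl, rfl⟩ := h
  simp [Real.volume_pi_Ioo]

/-- The metric on `Fin d → ℝ` is the sup metric, so covering and differentiation theorems for balls
apply to cubes. -/
theorem isCube_iff_exists_ball {Q : Set (Fin d → ℝ)} :
    IsCube Q ↔ ∃ x r, 0 < r ∧ Q = Metric.ball x r := by
  constructor
  · rintro ⟨a, l, hl, rfl⟩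
    refine ⟨fun i => a i + l / 2, l / 2, by positivity, ?_⟩
    rw [ball_pi _ (by positivity)]
    congr! 2 with i
    rw [Real.ball_eq_Ioo]
    ring_nf
  · rintro ⟨x, r, hr, rfl⟩
    refine ⟨fun i => x i - r, 2 * r, by positivity, ?_⟩
    rw [ball_pi _ hr]
    congr! 2 with i
    rw [Real.ball_eq_Ioo]
    ring_nf

theorem isCube_ball (x : Fin d → ℝ) {r : ℝ} (hr : 0 < r) : IsCube (Metric.ball x r) :=
  isCube_iff_exists_ball.2 ⟨x, r, hr, rfl⟩

theorem lt_maximal_iff {f : (Fin d → ℝ) → ℝ} {x : Fin d → ℝ} {s : ℝ≥0∞} :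
    s < maximal f x ↔ ∃ Q, IsCube Q ∧ x ∈ Q ∧ s * volume Q < ∫⁻ y in Q, ‖f y‖ₑ := by
  simp only [maximal, lt_iSup_iff, exists_prop]
  refine exists_congr fun Q => and_congr_right fun hQ => and_congr_right fun _ => ?_
  exact ENNReal.lt_div_iff_mul_lt (Or.inl hQ.volume_ne_zero) (Or.inl hQ.volume_ne_top)

theorem isOpen_lt_maximal (f : (Fin d → ℝ) → ℝ) (s : ℝ≥0∞) : IsOpen {x | s < maximal f x} := by
  rw [isOpen_iff_forall_mem_open]
  intro x hx
  obtain ⟨Q, hQ, hxQ, h⟩ := lt_maximal_iff.1 hx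
  exact ⟨Q, fun y hy => lt_maximal_iff.2 ⟨Q, hQ, hy, h⟩, hQ.isOpen, hxQ⟩

theorem measurable_maximal (f : (Fin d → ℝ) → ℝ) : Measurable (maximal f) :=
  LowerSemicontinuous.measurable <| lowerSemicontinuous_iff_isOpen_preimage.2 fun s =>
    isOpen_lt_maximal f s

/-- The set where the maximal function of the characteristic function of `E` exceeds `s`. -/
def superlevel (E : Set (Fin d → ℝ)) (s : ℝ≥0∞) : Set (Fin d → ℝ) :=
  {x | ∃ Q, IsCube Q ∧ x ∈ Q ∧ s * volume Q < volume (E ∩ Q)}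

theorem superlevel_anti (E : Set (Fin d → ℝ)) {s t : ℝ≥0∞} (h : s ≤ t) :
    superlevel E t ⊆ superlevel E s := by
  rintro x ⟨Q, hQ, hx, hlt⟩
  exact ⟨Q, hQ, hx, lt_of_le_of_lt (by gcongr) hlt⟩

theorem isOpen_superlevel (E : Set (Fin d → ℝ)) (s : ℝ≥0∞) : IsOpen (superlevel E s) := by
  rw [isOpen_iff_forall_mem_open]
  rintro x ⟨Q, hQ, hx, hlt⟩
  exact ⟨Q, fun y hy => ⟨Q, hQ, hy, hlt⟩, hQ.isOpen, hx⟩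

theorem weightOf_iUnion_nat (g : ℕ → Set (Fin d → ℝ)) :
    weightOf u (⋃ n, g n) = ⨆ N : ℕ, weightOf u (⋃ j : Fin N, g j) := by
  have h : (⋃ n, g n) = ⋃ N : ℕ, ⋃ j : Fin N, g j := by
    ext x
    simp only [mem_iUnion]
    exact ⟨fun ⟨n, hn⟩ => ⟨n + 1, ⟨n, n.lt_succ_self⟩, hn⟩, fun ⟨_, j, hj⟩ => ⟨j, hj⟩⟩
  rw [h]
  refine setLIntegral_iUnion_of_directed _ (Monotone.directed_le fun M N hMN => ?_)
  exact iUnion_subset fun j => subset_iUnion_of_subset (Fin.castLE hMN j) subset_rfl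

/-! ### From the geometric condition to the strong type estimate. -/

/-- The level set is a union of open cubes with `|Q| / |E ∩ Q| ≤ s⁻¹`. The Lindelöf property and
left continuity of `W` leave finitely many of them, to which the condition applies with `S = E ∩ Q`.
-/
theorem primitive_weightOf_superlevel_le {q : ℝ} (hq : 0 < q) {C : ℝ≥0} (hC : 0 < C)
    (hgeo : ∀ (J : ℕ) (Q S : Fin J → Set (Fin d → ℝ)),
      (∀ j, IsCube (Q j)) → (∀ j, NullMeasurableSet (S j) volume) → (∀ j, S j ⊆ Q j) →
        primitive w (weightOf u (⋃ j, Q j)) / primitive w (weightOf u (⋃ j, S j)) ≤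
          C * ⨆ j, (volume (Q j) / volume (S j)) ^ q)
    {E : Set (Fin d → ℝ)} (hE : NullMeasurableSet E volume) {s : ℝ≥0∞} (hs0 : s ≠ 0)
    (hs : s ≠ ∞) :
    primitive w (weightOf u (superlevel E s)) ≤
      C * s⁻¹ ^ q * primitive w (weightOf u E) := by
  set I : Set (Set (Fin d → ℝ)) := {Q | IsCube Q ∧ s * volume Q < volume (E ∩ Q)} with hI
  have hsup : superlevel E s = ⋃ Q ∈ I, Q := by
    ext x
    simp only [superlevel, hI, mem_ofPred_eq, mem_iUnion, exists_prop]
    exact exists_congr fun Q => by tauto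
  obtain ⟨T, hTI, hTc, hT⟩ :=
    TopologicalSpace.isOpen_biUnion_countable I id fun Q hQ => hQ.1.isOpen
  rcases T.eq_empty_or_nonempty with rfl | hne
  · have : superlevel E s = ∅ := by
      rw [hsup]; simpa using hT.symm
    simp [this, weightOf]
  obtain ⟨g, rfl⟩ := hTc.exists_eq_range hne
  have hg : ∀ n, g n ∈ I := fun n => hTI (mem_range_self n)
  have hsup' : superlevel E s = ⋃ n, g n := by
    rw [hsup]
    simpa using hT.symm
  rw [hsup', weightOf_iUnion_nat, primitive_iSup]
  refine iSup_le fun N => ?_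
  have h := hgeo N (fun j => g j) (fun j => E ∩ g j) (fun j => (hg j).1)
    (fun j => hE.inter (hg j).1.isOpen.measurableSet.nullMeasurableSet)
    (fun j => inter_subset_right)
  have hpow0 : s⁻¹ ^ q ≠ 0 := by
    simp [ENNReal.rpow_eq_zero_iff, hs, hq.not_gt]
  have hpow : s⁻¹ ^ q ≠ ∞ := ENNReal.rpow_ne_top_of_nonneg hq.le (ENNReal.inv_ne_top.2 hs0)
  have hC0 : (C : ℝ≥0∞) ≠ 0 := by exact_mod_cast hC.ne'
  have hle : (⨆ j : Fin N, (volume (g j) / volume (E ∩ g j)) ^ q) ≤ s⁻¹ ^ q := by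
    refine iSup_le fun j => ENNReal.rpow_le_rpow (ENNReal.div_le_of_le_mul ?_) hq.le
    rw [← ENNReal.div_eq_inv_mul, ENNReal.le_div_iff_mul_le (Or.inl hs0) (Or.inl hs), mul_comm]
    exact (hg j).2.le
  have h2 : primitive w (weightOf u (⋃ j : Fin N, g j)) /
      primitive w (weightOf u (⋃ j : Fin N, E ∩ g j)) ≤ C * s⁻¹ ^ q :=
    h.trans (by gcongr)
  rw [ENNReal.div_le_iff_le_mul (Or.inr (ENNReal.mul_ne_top ENNReal.coe_ne_top hpow))
    (Or.inr (mul_ne_zero hC0 hpow0))] at h2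
  refine h2.trans ?_
  gcongr
  exact primitive_mono (weightOf_mono (iUnion_subset fun j => inter_subset_left))

theorem nullMeasurableSet_lt_enorm {f : (Fin d → ℝ) → ℝ} (hf : AEMeasurable f volume)
    (s : ℝ≥0∞) : NullMeasurableSet {y | s < ‖f y‖ₑ} volume :=
  nullMeasurableSet_lt aemeasurable_const hf.enorm

/-- Splitting `f` according to the size of `|f|` reduces its maximal function to those of
characteristic functions. -/
theorem exists_mem_superlevel_of_lt_maximal {f : (Fin d → ℝ) → ℝ} (hf : AEMeasurable f volume)
    {a t : ℝ} (ha : 1 < a) (ht : 0 < t) {x : Fin d → ℝ}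
    (hx : ENNReal.ofReal ((1 + 2 * a) * t) < maximal f x) :
    ∃ k : ℕ, x ∈ superlevel {y | ENNReal.ofReal (a ^ k * t) < ‖f y‖ₑ}
      (ENNReal.ofReal ((2 * a) ^ k))⁻¹ := by
  have ha0 : 0 < a := one_pos.trans ha
  obtain ⟨Q, hQ, hxQ, hlt⟩ := lt_maximal_iff.1 hx
  -- Otherwise each `E k` fills at most the fraction `(2a)^(-k)` of `Q`, and the average of `|f|`
  -- over `Q` is at most `t + ∑ a^(k+1) t (2a)^(-k) = (1 + 2a)t`.
  by_contra! hcon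
  set E : ℕ → Set (Fin d → ℝ) := fun k => {y | ENNReal.ofReal (a ^ k * t) < ‖f y‖ₑ} with hE
  have hEm : ∀ k, NullMeasurableSet (E k) volume := fun k => nullMeasurableSet_lt_enorm hf _
  have hvol : ∀ k, volume (E k ∩ Q) ≤ (ENNReal.ofReal ((2 * a) ^ k))⁻¹ * volume Q := fun k =>
    not_lt.1 fun h => hcon k ⟨Q, hQ, hxQ, h⟩
  have hpt : ∀ y, ‖f y‖ₑ ≤ ENNReal.ofReal t +
      ∑' k, (E k).indicator (fun _ => ENNReal.ofReal (a ^ (k + 1) * t)) y := fun y => by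
    rcases le_total |f y| t with h | h
    · refine le_add_right ?_
      rw [← ofReal_norm]
      exact ENNReal.ofReal_le_ofReal h
    · rcases h.eq_or_lt with h | h
      · refine le_add_right ?_
        rw [← ofReal_norm]
        exact ENNReal.ofReal_le_ofReal h.ge
      · have hex : ∃ k : ℕ, a ^ k * t < |f y| ∧ |f y| ≤ a ^ (k + 1) * t := by
          obtain ⟨n, hn, hmin⟩ : ∃ n : ℕ, |f y| ≤ a ^ n * t ∧ ∀ m < n, a ^ m * t < |f y| := by
            have hex : ∃ n : ℕ, |f y| ≤ a ^ n * t := by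
              obtain ⟨n, hn⟩ := pow_unbounded_of_one_lt (|f y| / t) ha
              exact ⟨n, ((div_lt_iff₀ ht).1 hn).le⟩
            classical
            exact ⟨Nat.find hex, Nat.find_spec hex, fun m hm => not_le.1 (Nat.find_min hex hm)⟩
          cases n with
          | zero => simp only [pow_zero, one_mul] at hn; exact absurd hn (not_le.2 h)
          | succ n => exact ⟨n, hmin n n.lt_succ_self, hn⟩
        obtain ⟨k, hk1, hk2⟩ := hex
        refine le_add_left ?_
        have hy : y ∈ E k := by
          change _ < ‖f y‖ₑ
          rw [← ofReal_norm]
          exact (ENNReal.ofReal_lt_ofReal_iff (lt_of_le_of_lt (by positivity) hk1)).2 hk1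
        calc ‖f y‖ₑ ≤ (E k).indicator (fun _ => ENNReal.ofReal (a ^ (k + 1) * t)) y := by
              rw [indicator_of_mem hy, ← ofReal_norm]
              exact ENNReal.ofReal_le_ofReal hk2
          _ ≤ _ := ENNReal.le_tsum
              (f := fun k => (E k).indicator (fun _ => ENNReal.ofReal (a ^ (k + 1) * t)) y) k
  refine hlt.not_ge ?_
  calc ∫⁻ y in Q, ‖f y‖ₑ
      ≤ ∫⁻ y in Q, (ENNReal.ofReal t +
          ∑' k, (E k).indicator (fun _ => ENNReal.ofReal (a ^ (k + 1) * t)) y) :=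
        lintegral_mono fun y => hpt y
    _ = ENNReal.ofReal t * volume Q +
          ∑' k, ∫⁻ y in Q, (E k).indicator (fun _ => ENNReal.ofReal (a ^ (k + 1) * t)) y := by
        rw [lintegral_add_left measurable_const, setLIntegral_const, lintegral_tsum]
        exact fun k => aemeasurable_const.indicator₀ ((hEm k).mono_ac Measure.restrict_le_self.absolutelyContinuous)
    _ ≤ ENNReal.ofReal t * volume Q +
          ∑' k : ℕ, (2⁻¹ : ℝ≥0∞) ^ k * (ENNReal.ofReal (a * t) * volume Q) := by
        gcongr with k
        refine (lintegral_indicator_const_le _ _).trans ?_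
        rw [Measure.restrict_apply' hQ.isOpen.measurableSet]
        refine (mul_le_mul_right (hvol k) _).trans_eq ?_
        rw [← mul_assoc, ← mul_assoc]
        congr 1
        rw [← ENNReal.ofReal_inv_of_pos (by positivity), ← ENNReal.ofReal_ofNat,
          ← ENNReal.ofReal_inv_of_pos (by positivity), ← ENNReal.ofReal_pow (by positivity),
          ← ENNReal.ofReal_mul (by positivity), ← ENNReal.ofReal_mul (by positivity)]
        congr 1
        rw [mul_pow, inv_pow, pow_succ]
        field_simp
    _ = ENNReal.ofReal ((1 + 2 * a) * t) * volume Q := by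
        rw [ENNReal.tsum_mul_right, ENNReal.tsum_geometric, ENNReal.one_sub_inv_two, inv_inv,
          ← mul_assoc, ← add_mul, ← ENNReal.ofReal_ofNat, ← ENNReal.ofReal_mul (by positivity),
          ← ENNReal.ofReal_add (by positivity) (by positivity)]
        congr 2
        ring

theorem primitive_distribution_maximal_le {q : ℝ} (hq : 0 < q) {C c : ℝ≥0} (hC : 0 < C)
    (hgeo : ∀ (J : ℕ) (Q S : Fin J → Set (Fin d → ℝ)),
      (∀ j, IsCube (Q j)) → (∀ j, NullMeasurableSet (S j) volume) → (∀ j, S j ⊆ Q j) →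
        primitive w (weightOf u (⋃ j, Q j)) / primitive w (weightOf u (⋃ j, S j)) ≤
          C * ⨆ j, (volume (Q j) / volume (S j)) ^ q)
    (hc : ∀ t : ℝ≥0∞, primitive w (2 * t) ≤ c * primitive w t)
    {f : (Fin d → ℝ) → ℝ} (hf : AEMeasurable f volume)
    {a t : ℝ} (ha : 1 < a) (ht : 0 < t) :
    primitive w (distribution u (maximal f) ((1 + 2 * a) * t)) ≤
      c * ∑' k : ℕ, (c : ℝ≥0∞) ^ k * (C * ENNReal.ofReal ((2 * a) ^ k) ^ q *
        primitive w (distribution u f (a ^ k * t))) := by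
  have ha0 : 0 < a := one_pos.trans ha
  set F : ℕ → Set (Fin d → ℝ) := fun k =>
    superlevel {y | ENNReal.ofReal (a ^ k * t) < ‖f y‖ₑ} (ENNReal.ofReal ((2 * a) ^ k))⁻¹
  have h1 : distribution u (maximal f) ((1 + 2 * a) * t) ≤ ∑' k, weightOf u (F k) := by
    refine (weightOf_mono fun x hx => ?_).trans (lintegral_iUnion_le F _)
    exact mem_iUnion.2 (exists_mem_superlevel_of_lt_maximal hf ha ht (by simpa using hx))
  refine (primitive_mono h1).trans ((primitive_tsum_le hc _).trans ?_)
  gcongr with k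
  have := primitive_weightOf_superlevel_le hq hC hgeo
    (nullMeasurableSet_lt_enorm hf (ENNReal.ofReal (a ^ k * t)))
    (s := (ENNReal.ofReal ((2 * a) ^ k))⁻¹) (by simp)
    (ENNReal.inv_ne_top.2 (ENNReal.ofReal_pos.2 (by positivity)).ne')
  rwa [inv_inv] at this

theorem lintegral_Ioi_rpow_mul_comp_mul (hp : 0 ≤ p) (G : ℝ → ℝ≥0∞) {b : ℝ} (hb : 0 < b) :
    ∫⁻ t in Ioi (0 : ℝ), ENNReal.ofReal (p * t ^ (p - 1)) * G t =
      ENNReal.ofReal (b ^ p) *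
        ∫⁻ t in Ioi (0 : ℝ), ENNReal.ofReal (p * t ^ (p - 1)) * G (b * t) := by
  have himg : (fun t => b * t) '' Ioi (0 : ℝ) = Ioi 0 := by
    rw [image_mul_left_Ioi hb, mul_zero]
  have h := lintegral_image_eq_lintegral_abs_deriv_mul (s := Ioi (0 : ℝ)) (f := fun t => b * t)
    (f' := fun _ => b) measurableSet_Ioi
    (fun x _ => by simpa using ((hasDerivAt_id x).const_mul b).hasDerivWithinAt)
    ((mul_right_injective₀ hb.ne').injOn)
    (fun t => ENNReal.ofReal (p * t ^ (p - 1)) * G t)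
  rw [himg] at h
  rw [h, ← lintegral_const_mul' _ _ ENNReal.ofReal_ne_top]
  refine setLIntegral_congr_fun measurableSet_Ioi fun t ht => ?_
  have ht : 0 < t := ht
  rw [← mul_assoc, ← mul_assoc, ← ENNReal.ofReal_mul (by positivity),
    ← ENNReal.ofReal_mul (by positivity), abs_of_pos hb, Real.mul_rpow hb.le ht.le]
  congr 2
  have : b ^ p = b * b ^ (p - 1) := by
    rw [mul_comm, Real.rpow_sub_one hb.ne', div_mul_cancel₀ _ hb.ne']
  rw [this]
  ring

/-- The `p`-th power of `‖f‖_{Λ^p_u(w)}`. -/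
def lorentzIntegral {ε : Type*} [ENorm ε] (p : ℝ) (u : (Fin d → ℝ) → ℝ) (w : ℝ → ℝ)
    (f : (Fin d → ℝ) → ε) : ℝ≥0∞ :=
  ∫⁻ t in Ioi (0 : ℝ), ENNReal.ofReal (p * t ^ (p - 1)) * primitive w (distribution u f t)

theorem GeometricCondition.exists_lorentzIntegral_maximal_le (hp : 0 < p) (hΔ : DeltaTwo w)
    (h : GeometricCondition p u w) :
    ∃ B : ℝ≥0, ∀ f : (Fin d → ℝ) → ℝ, AEMeasurable f volume →
      lorentzIntegral p u w (maximal f) ≤ B * lorentzIntegral p u w f := by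
  obtain ⟨c, hc⟩ := hΔ.exists_primitive_two_mul_le
  obtain ⟨q, hq, hqp, C, hC, hgeo⟩ := h
  -- This says exactly that the ratio `r = c (2a)^q / a^p` below is less than 1; such `a` exists
  -- because `q < p`.
  obtain ⟨a, ha, hac⟩ : ∃ a : ℝ, 1 < a ∧ c * 2 ^ q < a ^ (p - q) :=
    (((Filter.eventually_gt_atTop 1).and ((tendsto_rpow_atTop (sub_pos.2 hqp)).eventually_gt_atTop
      ((c : ℝ) * 2 ^ q)))).exists
  have ha0 : 0 < a := one_pos.trans ha
  set A : ℝ := 1 + 2 * a with hA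
  have hA0 : 0 < A := by positivity
  set r : ℝ := c * (2 * a) ^ q / a ^ p with hr
  have hr0 : 0 ≤ r := by positivity
  have hr1 : r < 1 := by
    rw [hr, div_lt_one (by positivity), Real.mul_rpow zero_le_two ha0.le, ← mul_assoc]
    rwa [Real.rpow_sub ha0, lt_div_iff₀ (by positivity)] at hac
  have hgeom : ∑' k : ℕ, ENNReal.ofReal r ^ k ≠ ∞ := by
    rw [ENNReal.tsum_geometric]
    refine ENNReal.inv_ne_top.2 (tsub_pos_of_lt ?_).ne'
    rw [← ENNReal.ofReal_one]
    exact (ENNReal.ofReal_lt_ofReal_iff one_pos).2 hr1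
  set B : ℝ≥0∞ := ENNReal.ofReal (A ^ p) * (c * (C * ∑' k : ℕ, ENNReal.ofReal r ^ k)) with hB
  have hBtop : B ≠ ∞ := by finiteness
  refine ⟨B.toNNReal, fun f hf => ?_⟩
  rw [ENNReal.coe_toNNReal hBtop]
  set I := lorentzIntegral p u w f with hI
  -- The dilation `t ↦ a^k t` contributes the factor `a^(-kp)`.
  have hscale : ∀ k : ℕ, ENNReal.ofReal ((c * (2 * a) ^ q) ^ k) * ∫⁻ t in Ioi (0 : ℝ),
      ENNReal.ofReal (p * t ^ (p - 1)) * primitive w (distribution u f (a ^ k * t)) =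
        ENNReal.ofReal r ^ k * I := fun k => by
    have hak : 0 < a ^ k := by positivity
    have hG := lintegral_Ioi_rpow_mul_comp_mul hp.le
      (fun t => primitive w (distribution u f t)) hak
    rw [hI, lorentzIntegral, hG, ← mul_assoc,
      ← ENNReal.ofReal_pow hr0, ← ENNReal.ofReal_mul (by positivity)]
    congr 2
    rw [hr, div_pow, ← Real.rpow_natCast_mul ha0.le, mul_comm (k : ℝ) p,
      Real.rpow_mul_natCast ha0.le]
    field_simp
  calc lorentzIntegral p u w (maximal f)
      = ENNReal.ofReal (A ^ p) * ∫⁻ t in Ioi (0 : ℝ), ENNReal.ofReal (p * t ^ (p - 1)) *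
          primitive w (distribution u (maximal f) (A * t)) :=
        lintegral_Ioi_rpow_mul_comp_mul hp.le _ hA0
    _ ≤ ENNReal.ofReal (A ^ p) * ∫⁻ t in Ioi (0 : ℝ), c * (C * ∑' k : ℕ,
          ENNReal.ofReal ((c * (2 * a) ^ q) ^ k) * (ENNReal.ofReal (p * t ^ (p - 1)) *
            primitive w (distribution u f (a ^ k * t)))) := by
        refine mul_le_mul_right (setLIntegral_mono' measurableSet_Ioi fun t ht => ?_) _
        refine (mul_le_mul_right
          (primitive_distribution_maximal_le hq hC hgeo hc hf ha ht) _).trans_eq ?_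
        rw [mul_left_comm]
        congr 1
        rw [← ENNReal.tsum_mul_left, ← ENNReal.tsum_mul_left]
        refine tsum_congr fun k => ?_
        have : ENNReal.ofReal ((c * (2 * a) ^ q) ^ k) =
            (c : ℝ≥0∞) ^ k * ENNReal.ofReal ((2 * a) ^ k) ^ q := by
          rw [mul_pow, ENNReal.ofReal_mul (by positivity), ENNReal.ofReal_pow (by positivity),
            ENNReal.ofReal_coe_nnreal, ENNReal.ofReal_rpow_of_pos (by positivity),
            ← Real.rpow_natCast_mul (by positivity), mul_comm (k : ℝ) q,
            Real.rpow_mul_natCast (by positivity)]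
        rw [this]
        ring
    _ = B * I := by
        have hm : ∀ k : ℕ, Measurable fun t : ℝ => ENNReal.ofReal (p * t ^ (p - 1)) *
            primitive w (distribution u f (a ^ k * t)) := fun k =>
          Measurable.mul (by fun_prop)
            ((measurable_primitive_distribution f).comp (measurable_const_mul _))
        rw [lintegral_const_mul' _ _ ENNReal.coe_ne_top,
          lintegral_const_mul' _ _ ENNReal.coe_ne_top,
          lintegral_tsum fun k => ((hm k).const_mul _).aemeasurable]
        simp_rw [lintegral_const_mul' _ _ ENNReal.ofReal_ne_top, hscale]
        rw [ENNReal.tsum_mul_right, hB]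
        ring

theorem GeometricCondition.strongTypeBounded (hp : 0 < p) (hΔ : DeltaTwo w)
    (h : GeometricCondition p u w) : StrongTypeBounded p u w := by
  obtain ⟨B, hB⟩ := h.exists_lorentzIntegral_maximal_le hp hΔ
  have hp' : 0 ≤ 1 / p := by positivity
  have key : ∀ f : (Fin d → ℝ) → ℝ, AEMeasurable f volume →
      lorentzNorm p u w (maximal f) ≤ (B ^ (1 / p) : ℝ≥0) * lorentzNorm p u w f := fun f hf => by
    rw [ENNReal.coe_rpow_of_nonneg _ hp']
    refine (ENNReal.rpow_le_rpow (hB f hf) hp').trans_eq ?_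
    rw [ENNReal.mul_rpow_of_nonneg _ _ hp']
    rfl
  exact ⟨B ^ (1 / p), fun f hf => ⟨⟨(measurable_maximal f).aemeasurable,
    (key f hf.1).trans_lt (ENNReal.mul_lt_top ENNReal.coe_lt_top hf.2)⟩, key f hf.1⟩⟩

/-! ### Strong type implies weak type (Chebyshev). -/

theorem lintegral_Ioc_rpow (hp : 0 < p) {t : ℝ} (ht : 0 ≤ t) :
    ∫⁻ s in Ioc 0 t, ENNReal.ofReal (p * s ^ (p - 1)) = ENNReal.ofReal (t ^ p) := by
  rw [← ofReal_integral_eq_lintegral_ofReal]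
  · rw [← intervalIntegral.integral_of_le ht, intervalIntegral.integral_const_mul,
      integral_rpow (Or.inl (by linarith)), sub_add_cancel, Real.zero_rpow hp.ne', sub_zero,
      mul_div_cancel₀ _ hp.ne']
  · rw [← IntegrableOn, ← intervalIntegrable_iff_integrableOn_Ioc_of_le ht]
    exact (intervalIntegral.intervalIntegrable_rpow' (by linarith)).const_mul p
  · filter_upwards [ae_restrict_mem measurableSet_Ioc] with s hs
    have := hs.1
    simp only [Pi.zero_apply]
    positivity

theorem weakLorentzNorm_le_lorentzNorm {ε : Type*} [ENorm ε] (hp : 0 < p)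
    (f : (Fin d → ℝ) → ε) : weakLorentzNorm p u w f ≤ lorentzNorm p u w f := by
  refine iSup₂_le fun t ht => ?_
  have h : ENNReal.ofReal t * primitive w (distribution u f t) ^ (1 / p) =
      (ENNReal.ofReal (t ^ p) * primitive w (distribution u f t)) ^ (1 / p) := by
    rw [ENNReal.mul_rpow_of_nonneg _ _ (by positivity), ENNReal.ofReal_rpow_of_pos (by positivity),
      ← Real.rpow_mul ht.le, mul_one_div_cancel hp.ne', Real.rpow_one]
  rw [h]
  refine ENNReal.rpow_le_rpow ?_ (by positivity)
  rw [← lintegral_Ioc_rpow hp ht.le, ← lintegral_mul_const _ (by fun_prop)]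
  refine (setLIntegral_mono' measurableSet_Ioc fun s hs => ?_).trans
    (lintegral_mono_set Ioc_subset_Ioi_self)
  gcongr
  exact primitive_mono (distribution_antitone f hs.2)

theorem StrongTypeBounded.weakTypeBounded (hp : 0 < p) (h : StrongTypeBounded p u w) :
    WeakTypeBounded p u w := by
  obtain ⟨C, hC⟩ := h
  refine ⟨C, fun f hf => ?_⟩
  obtain ⟨h1, h2⟩ := hC f hf
  have h3 := weakLorentzNorm_le_lorentzNorm (u := u) (w := w) hp (maximal f)
  exact ⟨⟨h1.1, h3.trans_lt h1.2⟩, h3.trans h2⟩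

/-! ### A reverse weak type inequality and the composition of level sets. -/

/-- Every point of `superlevel E s ∩ ball c ρ` lies in a ball inside this set whose threefold
enlargement leaves `superlevel E s`. -/
theorem exists_closedBall_subset_superlevel {E : Set (Fin d → ℝ)} {s : ℝ≥0∞} {c : Fin d → ℝ}
    {ρ : ℝ} (hρ : 0 < ρ) (hnot : ¬Metric.ball c ρ ⊆ superlevel E s) {x : Fin d → ℝ}
    (hx : x ∈ superlevel E s ∩ Metric.ball c ρ) :
    ∃ z r, (0 < r ∧ r ≤ ρ) ∧ x ∈ Metric.closedBall z r ∧
      Metric.closedBall z r ⊆ superlevel E s ∩ Metric.ball c ρ ∧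
      ∃ y ∈ Metric.closedBall z (3 * r), y ∉ superlevel E s := by
  have hxc : ‖c - x‖ < ρ := by
    rw [← dist_eq_norm, dist_comm]
    exact hx.2
  -- These balls are the images of `closedBall c ρ` under the homotheties with centre `x` and ratio
  -- `2^(-k)`. All contain `x`, and small ones lie in the open level set. The ball sought is one
  -- that lies in it while the ball of twice its size does not.
  set P : ℕ → Prop := fun k => Metric.closedBall (x + (2⁻¹ : ℝ) ^ k • (c - x)) ((2⁻¹ : ℝ) ^ k * ρ) ⊆
    superlevel E s with hP
  have hP0 : ¬P 0 := fun h => hnot <| by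
    simp only [hP, pow_zero, one_smul, add_sub_cancel, one_mul] at h
    exact Metric.ball_subset_closedBall.trans h
  have hdist : ∀ θ : ℝ, 0 ≤ θ → dist x (x + θ • (c - x)) ≤ θ * ρ := fun θ hθ => by
    rw [dist_self_add_right, norm_smul, Real.norm_of_nonneg hθ]
    gcongr
  have hex : ∃ k, P k := by
    obtain ⟨ε, hε, hball⟩ := Metric.isOpen_iff.1 (isOpen_superlevel E s) x hx.1
    obtain ⟨k, hk⟩ := exists_pow_lt_of_lt_one (show 0 < ε / (2 * ρ) by positivity)
      (show (2⁻¹ : ℝ) < 1 by norm_num)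
    refine ⟨k, fun v hv => hball ?_⟩
    rw [lt_div_iff₀ (by positivity)] at hk
    rw [Metric.mem_ball]
    have h1 := dist_triangle v (x + (2⁻¹ : ℝ) ^ k • (c - x)) x
    have h2 := hdist ((2⁻¹ : ℝ) ^ k) (by positivity)
    rw [dist_comm] at h2
    rw [Metric.mem_closedBall] at hv
    linarith
  obtain ⟨k, hk, hk1⟩ : ∃ k, ¬P k ∧ P (k + 1) := by
    by_contra! hcon
    obtain ⟨k, hk⟩ := hex
    exact (Nat.rec hP0 (fun n hn => hcon n hn) k : ¬P k) hk
  obtain ⟨y, hy, hyG⟩ := not_subset.1 hk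
  set θ : ℝ := (2⁻¹ : ℝ) ^ (k + 1) with hθ
  have hθ0 : 0 < θ := by positivity
  have hθ1 : θ < 1 := pow_lt_one₀ (by norm_num) (by norm_num) k.succ_ne_zero
  have hθ2 : (2⁻¹ : ℝ) ^ k = 2 * θ := by rw [hθ, pow_succ]; ring
  refine ⟨x + θ • (c - x), θ * ρ, ⟨by positivity, by nlinarith⟩, hdist θ hθ0.le,
    subset_inter hk1 fun v hv => ?_, y, ?_, hyG⟩
  · have h1 := dist_triangle v (x + θ • (c - x)) c
    have h2 : dist (x + θ • (c - x)) c = (1 - θ) * ‖c - x‖ := by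
      rw [dist_comm, dist_eq_norm, show c - (x + θ • (c - x)) = (1 - θ) • (c - x) by module,
        norm_smul, Real.norm_of_nonneg (by linarith)]
    rw [Metric.mem_closedBall] at hv
    rw [Metric.mem_ball]
    nlinarith
  · have h1 := dist_triangle y (x + (2 * θ) • (c - x)) (x + θ • (c - x))
    have h2 : dist (x + (2 * θ) • (c - x)) (x + θ • (c - x)) = θ * ‖c - x‖ := by
      rw [dist_eq_norm, show x + (2 * θ) • (c - x) - (x + θ • (c - x)) = θ • (c - x) by module,
        norm_smul, Real.norm_of_nonneg hθ0.le]
    rw [hθ2, Metric.mem_closedBall] at hy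
    rw [Metric.mem_closedBall]
    nlinarith

theorem volume_ball_six_mul (z : Fin d → ℝ) {r : ℝ} (hr : 0 < r) :
    volume (Metric.ball z (6 * r)) = 6 ^ d * volume (Metric.closedBall z r) := by
  rw [Real.volume_pi_ball _ (by positivity), Real.volume_pi_closedBall _ hr.le, Fintype.card_fin,
    show 2 * (6 * r) = 6 * (2 * r) by ring, mul_pow, ENNReal.ofReal_mul (by positivity),
    ENNReal.ofReal_pow (by norm_num), ENNReal.ofReal_ofNat]

/-- Vitali's lemma selects disjoint balls inside `superlevel E s ∩ Q`. An enlargement of each meets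
the complement of the level set, so `E` has density at most `s` in it. -/
theorem volume_inter_superlevel_inter_le {E Q : Set (Fin d → ℝ)} {s : ℝ≥0∞} (hQ : IsCube Q)
    (hnot : ¬Q ⊆ superlevel E s) :
    volume (E ∩ (superlevel E s ∩ Q)) ≤ 6 ^ d * s * volume (superlevel E s ∩ Q) := by
  obtain ⟨c, ρ, hρ, rfl⟩ := isCube_iff_exists_ball.1 hQ
  set G := superlevel E s with hG
  choose! z r hr hx hsub y hy hyG using
    fun x (hx : x ∈ G ∩ Metric.ball c ρ) => exists_closedBall_subset_superlevel hρ hnot hx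
  obtain ⟨v, hv, hdisj, hcov⟩ := Vitali.exists_disjoint_subfamily_covering_enlargement_closedBall
    (G ∩ Metric.ball c ρ) z r ρ (fun x hx => (hr x hx).2) 5 (by norm_num)
  have hvc : v.Countable := hdisj.countable_of_nonempty_interior fun b hb =>
    ⟨z b, Metric.ball_subset_interior_closedBall (Metric.mem_ball_self (hr b (hv hb)).1)⟩
  -- The open ball of radius `6r` contains both the Vitali enlargement of radius `5r` and the
  -- exceptional point at distance at most `3r`.
  have hball : ∀ b ∈ v, volume (E ∩ Metric.ball (z b) (6 * r b)) ≤
      6 ^ d * s * volume (Metric.closedBall (z b) (r b)) := fun b hb => by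
    have hrb := (hr b (hv hb)).1
    have h : ¬s * volume (Metric.ball (z b) (6 * r b)) <
        volume (E ∩ Metric.ball (z b) (6 * r b)) := fun h =>
      hyG b (hv hb) ⟨_, isCube_ball _ (by positivity),
        Metric.closedBall_subset_ball (by linarith) (hy b (hv hb)), h⟩
    rw [volume_ball_six_mul _ hrb] at h
    refine (not_lt.1 h).trans_eq ?_
    ring
  calc volume (E ∩ (G ∩ Metric.ball c ρ))
      ≤ volume (⋃ b ∈ v, E ∩ Metric.ball (z b) (6 * r b)) := by
        refine measure_mono fun x hxm => ?_
        obtain ⟨b, hb, hxb⟩ := hcov x hxm.2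
        have hrb := (hr b (hv hb)).1
        exact mem_biUnion hb ⟨hxm.1, Metric.closedBall_subset_ball (by linarith)
          (hxb (hx x hxm.2))⟩
    _ ≤ ∑' b : v, volume (E ∩ Metric.ball (z b) (6 * r b)) := measure_biUnion_le _ hvc _
    _ ≤ ∑' b : v, 6 ^ d * s * volume (Metric.closedBall (z b) (r b)) :=
        ENNReal.tsum_le_tsum fun b => hball b b.2
    _ = 6 ^ d * s * volume (⋃ b ∈ v, Metric.closedBall (z b) (r b)) := by
        rw [ENNReal.tsum_mul_left,
          measure_biUnion hvc hdisj fun b _ => Metric.isClosed_closedBall.measurableSet]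
    _ ≤ 6 ^ d * s * volume (G ∩ Metric.ball c ρ) := by
        gcongr
        exact iUnion₂_subset fun b hb => hsub b (hv hb)

/-- By Lebesgue's density theorem, almost all of `E` lies in `superlevel E s` if `s < 1`. -/
theorem volume_diff_superlevel (hd : 0 < d) (E : Set (Fin d → ℝ)) {s : ℝ≥0∞} (hs : s < 1) :
    volume (E \ superlevel E s) = 0 := by
  have : Nonempty (Fin d) := ⟨⟨0, hd⟩⟩
  have h : ∀ᵐ x ∂volume.restrict E, x ∈ superlevel E s := by
    filter_upwards [Besicovitch.ae_tendsto_measure_inter_div volume E] with x hx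
    obtain ⟨r, hlt, hr⟩ := ((hx.eventually_const_lt hs).and self_mem_nhdsWithin).exists
    have hr : 0 < r := hr
    have hB := isCube_ball x hr
    have hvol : volume (Metric.closedBall x r) = volume (Metric.ball x r) := by
      rw [Real.volume_pi_ball _ hr, Real.volume_pi_closedBall _ hr.le]
    refine ⟨_, hB, Metric.mem_ball_self hr, ?_⟩
    rw [hvol, ENNReal.lt_div_iff_mul_lt (Or.inl hB.volume_ne_zero)
      (Or.inl hB.volume_ne_top)] at hlt
    refine hlt.trans_le ?_
    rw [← Metric.ball_union_sphere, inter_union_distrib_left]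
    refine (measure_union_le _ _).trans_eq ?_
    rw [measure_mono_null inter_subset_right (Measure.addHaar_sphere_of_ne_zero volume x hr.ne'),
      add_zero]
  have h : volume.restrict E (superlevel E s)ᶜ = 0 := mem_ae_iff.1 h
  rw [Measure.restrict_apply (isOpen_superlevel E s).measurableSet.compl] at h
  rwa [sdiff_eq, inter_comm]

theorem subset_superlevel_or_volume_inter_le (hd : 0 < d) {E Q : Set (Fin d → ℝ)} {s : ℝ≥0∞}
    (hs : s < 1) (hQ : IsCube Q) :
    Q ⊆ superlevel E s ∨ volume (E ∩ Q) ≤ 6 ^ d * s * volume (superlevel E s ∩ Q) := by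
  refine or_iff_not_imp_left.2 fun hnot => ?_
  calc volume (E ∩ Q)
      ≤ volume (E ∩ (superlevel E s ∩ Q) ∪ E \ superlevel E s) := by
        refine measure_mono fun x hx => ?_
        by_cases h : x ∈ superlevel E s
        · exact Or.inl ⟨hx.1, h, hx.2⟩
        · exact Or.inr ⟨hx.1, h⟩
    _ ≤ volume (E ∩ (superlevel E s ∩ Q)) := by
        refine (measure_union_le _ _).trans_eq ?_
        rw [volume_diff_superlevel hd E hs, add_zero]
    _ ≤ _ := volume_inter_superlevel_inter_le hQ hnot

/-- Makes level set estimates submultiplicative in the height. The same cube serves as witness: it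
either lies in the inner level set, or meets it in measure at least `|E ∩ Q| / (6^d s)`. -/
theorem superlevel_mul_subset (hd : 0 < d) (E : Set (Fin d → ℝ)) {s t : ℝ≥0∞} (hs : s < 1)
    (ht : t < 1) : superlevel E (6 ^ d * s * t) ⊆ superlevel (superlevel E s) t := by
  rintro x ⟨Q, hQ, hx, hlt⟩
  refine ⟨Q, hQ, hx, ?_⟩
  rcases subset_superlevel_or_volume_inter_le hd (E := E) hs hQ with h | h
  · rw [inter_eq_self_of_subset_right h]
    exact (ENNReal.mul_lt_mul_left hQ.volume_ne_zero hQ.volume_ne_top ht).trans_eq (one_mul _)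
  · refine lt_of_mul_lt_mul_left' (a := 6 ^ d * s) ?_
    rw [← mul_assoc]
    exact hlt.trans_le h

/-! ### Testing the weak type inequality on characteristic functions. -/

theorem WeakTypeBounded.exists_primitive_maximal_le (hp : 0 < p) (h : WeakTypeBounded p u w) :
    ∃ K : ℝ≥0, ∀ f : (Fin d → ℝ) → ℝ, AEMeasurable f volume → ∀ t : ℝ, 0 < t →
      ENNReal.ofReal (t ^ p) * primitive w (distribution u (maximal f) t) ≤
        K * lorentzIntegral p u w f := by
  obtain ⟨C, hC⟩ := h
  -- A nonzero constant keeps the inequality valid when the integral of `f` is infinite, where `0 *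
  -- ∞ = 0` would spoil it.
  refine ⟨max C 1 ^ p, fun f hf t ht => ?_⟩
  have hK : (max C 1 : ℝ≥0) ^ p ≠ 0 := (NNReal.rpow_pos (by positivity)).ne'
  rcases eq_or_ne (lorentzIntegral p u w f) ∞ with hI | hI
  · rw [hI, ENNReal.mul_top (by exact_mod_cast hK)]
    exact le_top
  have hmem : MemLorentz p u w f :=
    ⟨hf, ENNReal.rpow_lt_top_of_nonneg (by positivity) hI⟩
  have h1 : ENNReal.ofReal t * primitive w (distribution u (maximal f) t) ^ (1 / p) ≤
      max C 1 * lorentzIntegral p u w f ^ (1 / p) := by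
    refine (le_iSup₂ (f := fun (t : ℝ) (_ : 0 < t) => ENNReal.ofReal t *
      primitive w (distribution u (maximal f) t) ^ (1 / p)) t ht).trans ((hC f hmem).2.trans ?_)
    gcongr
    · exact_mod_cast le_max_left C 1
    · exact le_rfl
  have h2 := ENNReal.rpow_le_rpow h1 hp.le
  rwa [ENNReal.mul_rpow_of_nonneg _ _ hp.le, ENNReal.mul_rpow_of_nonneg _ _ hp.le,
    ← ENNReal.rpow_mul, ← ENNReal.rpow_mul, one_div_mul_cancel hp.ne', ENNReal.rpow_one,
    ENNReal.rpow_one, ENNReal.ofReal_rpow_of_pos ht,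
    ← ENNReal.coe_rpow_of_nonneg _ hp.le] at h2

theorem lt_maximal_indicator_iff {E : Set (Fin d → ℝ)} (hE : NullMeasurableSet E volume)
    {s : ℝ≥0∞} {x : Fin d → ℝ} :
    s < maximal (E.indicator fun _ => (1 : ℝ)) x ↔ x ∈ superlevel E s := by
  rw [lt_maximal_iff]
  refine exists_congr fun Q => and_congr_right fun hQ => and_congr_right fun _ => ?_
  have h : ∀ y, ‖E.indicator (fun _ => (1 : ℝ)) y‖ₑ = E.indicator (fun _ => (1 : ℝ≥0∞)) y :=
    fun y => by by_cases hy : y ∈ E <;> simp [hy]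
  simp_rw [h]
  rw [lintegral_indicator_const₀ (hE.mono_ac Measure.restrict_le_self.absolutelyContinuous),
    one_mul, Measure.restrict_apply' hQ.isOpen.measurableSet]

theorem superlevel_eq_empty {E : Set (Fin d → ℝ)} {s : ℝ≥0∞} (hs : 1 ≤ s) :
    superlevel E s = ∅ := by
  refine eq_empty_of_forall_notMem fun x ⟨Q, hQ, hx, h⟩ => h.not_ge ?_
  exact (measure_mono inter_subset_right).trans (le_mul_of_one_le_left' hs)

theorem maximal_indicator_le_one {E : Set (Fin d → ℝ)} (hE : NullMeasurableSet E volume)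
    (x : Fin d → ℝ) : maximal (E.indicator fun _ => (1 : ℝ)) x ≤ 1 := by
  refine not_lt.1 fun h => ?_
  rw [lt_maximal_indicator_iff hE, superlevel_eq_empty le_rfl] at h
  exact h

theorem lorentzIntegral_indicator_le (hp : 0 < p) (E : Set (Fin d → ℝ)) :
    lorentzIntegral p u w (E.indicator fun _ => (1 : ℝ)) ≤ primitive w (weightOf u E) := by
  have h : ∀ t ∈ Ioi (0 : ℝ), ENNReal.ofReal (p * t ^ (p - 1)) *
      primitive w (distribution u (E.indicator fun _ => (1 : ℝ)) t) ≤
      (Ioc 0 1).indicator (fun t => ENNReal.ofReal (p * t ^ (p - 1))) t *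
        primitive w (weightOf u E) := fun t ht => by
    by_cases ht1 : t ≤ 1
    · rw [indicator_of_mem (show t ∈ Ioc (0 : ℝ) 1 from ⟨ht, ht1⟩)]
      gcongr
      refine primitive_mono (weightOf_mono fun x hx => ?_)
      by_contra hxE
      simp [hxE] at hx
    · have h0 : distribution u (E.indicator fun _ => (1 : ℝ)) t = 0 := by
        have : {x | ENNReal.ofReal t < ‖E.indicator (fun _ => (1 : ℝ)) x‖ₑ} = ∅ := by
          refine eq_empty_of_forall_notMem fun x => ?_
          rw [mem_ofPred_eq, not_lt]
          have h1 : 1 ≤ ENNReal.ofReal t := by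
            rw [← ENNReal.ofReal_one]
            exact ENNReal.ofReal_le_ofReal (not_le.1 ht1).le
          refine le_trans ?_ h1
          by_cases hx : x ∈ E <;> simp [hx]
        rw [distribution, this]
        simp [weightOf]
      simp [h0]
  refine (setLIntegral_mono' measurableSet_Ioi h).trans ?_
  rw [lintegral_mul_const _ (Measurable.indicator (by fun_prop) measurableSet_Ioc),
    setLIntegral_indicator measurableSet_Ioc, inter_eq_self_of_subset_left Ioc_subset_Ioi_self,
    lintegral_Ioc_rpow hp zero_le_one]
  simp

theorem primitive_superlevel_le {K : ℝ≥0} (hp : 0 < p)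
    (hK : ∀ f : (Fin d → ℝ) → ℝ, AEMeasurable f volume → ∀ t : ℝ, 0 < t →
      ENNReal.ofReal (t ^ p) * primitive w (distribution u (maximal f) t) ≤
        K * lorentzIntegral p u w f)
    {E : Set (Fin d → ℝ)} (hE : NullMeasurableSet E volume) {t : ℝ} (ht : 0 < t) :
    primitive w (weightOf u (superlevel E (ENNReal.ofReal t))) ≤
      ENNReal.ofReal (t ^ (-p)) * (K * primitive w (weightOf u E)) := by
  have h := hK (E.indicator fun _ => (1 : ℝ)) (aemeasurable_const.indicator₀ hE) t ht
  have hset : distribution u (maximal (E.indicator fun _ => (1 : ℝ))) t =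
      weightOf u (superlevel E (ENNReal.ofReal t)) := by
    simp only [distribution, enorm_eq_self, lt_maximal_indicator_iff hE]
    rfl
  rw [hset] at h
  calc primitive w (weightOf u (superlevel E (ENNReal.ofReal t)))
      = ENNReal.ofReal (t ^ (-p)) * (ENNReal.ofReal (t ^ p) *
          primitive w (weightOf u (superlevel E (ENNReal.ofReal t)))) := by
        rw [← mul_assoc, ← ENNReal.ofReal_mul (by positivity), ← Real.rpow_add ht]
        simp
    _ ≤ _ := by
        exact mul_le_mul_right (h.trans (mul_le_mul_right (lorentzIntegral_indicator_le hp E) _)) _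

/-! ### The logarithmic gain. -/

theorem lintegral_Ioc_inv {δ : ℝ} (hδ0 : 0 < δ) (hδ1 : δ < 1) :
    ∫⁻ t in Ioc δ 1, ENNReal.ofReal t⁻¹ = ENNReal.ofReal (Real.log δ⁻¹) := by
  rw [← ofReal_integral_eq_lintegral_ofReal]
  · rw [← intervalIntegral.integral_of_le hδ1.le, integral_inv_of_pos hδ0 one_pos, one_div]
  · rw [← IntegrableOn, ← intervalIntegrable_iff_integrableOn_Ioc_of_le hδ1.le]
    refine intervalIntegral.intervalIntegrable_inv (fun t ht => ?_) continuousOn_id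
    rw [uIcc_of_le hδ1.le] at ht
    exact (hδ0.trans_le ht.1).ne'
  · filter_upwards [ae_restrict_mem measurableSet_Ioc] with t ht
    exact inv_nonneg.2 (hδ0.trans ht.1).le

/-- The maximal function of the characteristic function of `E`, cut off below height `δ`. -/
def cutoffMaximal (E : Set (Fin d → ℝ)) (δ : ℝ) : (Fin d → ℝ) → ℝ :=
  (superlevel E (ENNReal.ofReal δ)).indicator fun x =>
    (maximal (E.indicator fun _ => (1 : ℝ)) x).toReal

theorem measurable_cutoffMaximal (E : Set (Fin d → ℝ)) (δ : ℝ) :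
    Measurable (cutoffMaximal E δ) :=
  (measurable_maximal _).ennreal_toReal.indicator (isOpen_superlevel _ _).measurableSet

theorem cutoffMaximal_nonneg (E : Set (Fin d → ℝ)) (δ : ℝ) (x : Fin d → ℝ) :
    0 ≤ cutoffMaximal E δ x :=
  indicator_nonneg (fun _ _ => ENNReal.toReal_nonneg) x

theorem lt_cutoffMaximal_iff {E : Set (Fin d → ℝ)} (hE : NullMeasurableSet E volume) {δ t : ℝ}
    (ht : 0 < t) {x : Fin d → ℝ} :
    t < cutoffMaximal E δ x ↔ x ∈ superlevel E (ENNReal.ofReal (max t δ)) := by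
  have htop : maximal (E.indicator fun _ => (1 : ℝ)) x ≠ ∞ :=
    ((maximal_indicator_le_one hE x).trans_lt ENNReal.one_lt_top).ne
  by_cases hx : x ∈ superlevel E (ENNReal.ofReal δ)
  · rw [cutoffMaximal, indicator_of_mem hx, ← ENNReal.ofReal_lt_iff_lt_toReal ht.le htop,
      lt_maximal_indicator_iff hE]
    rcases le_total t δ with h | h
    · rw [max_eq_right h]
      exact iff_of_true (superlevel_anti E (ENNReal.ofReal_le_ofReal h) hx) hx
    · rw [max_eq_left h]
  · rw [cutoffMaximal, indicator_of_notMem hx]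
    exact iff_of_false ht.not_gt fun h =>
      hx (superlevel_anti E (ENNReal.ofReal_le_ofReal (le_max_right t δ)) h)

/-- The level sets are constant below height `δ`, which gives the term 1, and empty from height 1
on. In between, the bound `t^(-p)` leaves `p ∫ dt/t`, the logarithm. -/
theorem lorentzIntegral_cutoffMaximal_le {K : ℝ≥0} (hp : 0 < p)
    (hK : ∀ f : (Fin d → ℝ) → ℝ, AEMeasurable f volume → ∀ t : ℝ, 0 < t →
      ENNReal.ofReal (t ^ p) * primitive w (distribution u (maximal f) t) ≤
        K * lorentzIntegral p u w f)
    {E : Set (Fin d → ℝ)} (hE : NullMeasurableSet E volume) {δ : ℝ} (hδ0 : 0 < δ) (hδ1 : δ < 1) :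
    lorentzIntegral p u w (cutoffMaximal E δ) ≤
      ENNReal.ofReal (1 + p * Real.log δ⁻¹) * (K * primitive w (weightOf u E)) := by
  set V := K * primitive w (weightOf u E) with hV
  have hdist : ∀ t : ℝ, 0 < t → distribution u (cutoffMaximal E δ) t =
      weightOf u (superlevel E (ENNReal.ofReal (max t δ))) := fun t ht => by
    rw [distribution]
    congr 1
    ext x
    rw [← lt_cutoffMaximal_iff hE ht, mem_ofPred_eq, ← ofReal_norm,
      Real.norm_of_nonneg (cutoffMaximal_nonneg E δ x), ENNReal.ofReal_lt_ofReal_iff_of_nonneg ht.le]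
  have hunion : Ioi (0 : ℝ) = (Ioc 0 δ ∪ Ioc δ 1) ∪ Ioi 1 := by
    rw [Ioc_union_Ioc_eq_Ioc hδ0.le hδ1.le, Ioc_union_Ioi_eq_Ioi zero_le_one]
  have h1 : ∫⁻ t in Ioc 0 δ, ENNReal.ofReal (p * t ^ (p - 1)) *
      primitive w (distribution u (cutoffMaximal E δ) t) ≤ V := by
    calc _ ≤ ∫⁻ t in Ioc 0 δ, ENNReal.ofReal (p * t ^ (p - 1)) *
          (ENNReal.ofReal (δ ^ (-p)) * V) := by
          refine setLIntegral_mono' measurableSet_Ioc fun t ht => ?_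
          rw [hdist t ht.1, max_eq_right ht.2]
          gcongr
          exact primitive_superlevel_le hp hK hE hδ0
      _ = V := by
          rw [lintegral_mul_const _ (by fun_prop), lintegral_Ioc_rpow hp hδ0.le, ← mul_assoc,
            ← ENNReal.ofReal_mul (by positivity), ← Real.rpow_add hδ0]
          simp
  have h2 : ∫⁻ t in Ioc δ 1, ENNReal.ofReal (p * t ^ (p - 1)) *
      primitive w (distribution u (cutoffMaximal E δ) t) ≤
        ENNReal.ofReal (p * Real.log δ⁻¹) * V := by
    calc _ ≤ ∫⁻ t in Ioc δ 1, ENNReal.ofReal p * (ENNReal.ofReal t⁻¹ * V) := by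
          refine setLIntegral_mono' measurableSet_Ioc fun t ht => ?_
          have ht0 : 0 < t := hδ0.trans ht.1
          rw [hdist t ht0, max_eq_left ht.1.le]
          refine (mul_le_mul_right (primitive_superlevel_le hp hK hE ht0) _).trans_eq ?_
          rw [← hV, ← mul_assoc, ← mul_assoc (ENNReal.ofReal p), ← ENNReal.ofReal_mul (by positivity),
            ← ENNReal.ofReal_mul (by positivity), mul_assoc p, ← Real.rpow_add ht0,
            show p - 1 + -p = -1 by ring, Real.rpow_neg_one]
      _ = _ := by
          rw [lintegral_const_mul' _ _ ENNReal.ofReal_ne_top, lintegral_mul_const _ (by fun_prop),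
            lintegral_Ioc_inv hδ0 hδ1, ← mul_assoc, ← ENNReal.ofReal_mul hp.le]
  have h3 : ∫⁻ t in Ioi (1 : ℝ), ENNReal.ofReal (p * t ^ (p - 1)) *
      primitive w (distribution u (cutoffMaximal E δ) t) ≤ 0 := by
    refine (setLIntegral_mono' (g := fun _ => 0) measurableSet_Ioi fun t ht => ?_).trans_eq (by simp)
    have ht : 1 < t := ht
    have ht' : 1 ≤ ENNReal.ofReal (max t δ) := by
      rw [← ENNReal.ofReal_one]
      exact ENNReal.ofReal_le_ofReal (ht.le.trans (le_max_left _ _))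
    rw [hdist t (one_pos.trans ht), superlevel_eq_empty ht']
    simp [weightOf]
  have hL : 0 ≤ Real.log δ⁻¹ := Real.log_nonneg ((one_le_inv₀ hδ0).2 hδ1.le)
  rw [lorentzIntegral, hunion, ENNReal.ofReal_add zero_le_one (by positivity),
    ENNReal.ofReal_one, add_mul, one_mul, ← add_zero (V + _)]
  exact (lintegral_union_le _ _ _).trans
    (add_le_add ((lintegral_union_le _ _ _).trans (add_le_add h1 h2)) h3)

/-- A local `L log L` lower bound for the average of a maximal function. -/
theorem ofReal_mul_volume_le_lintegral_cutoffMaximal (hd : 0 < d) {E Q : Set (Fin d → ℝ)}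
    (hE : NullMeasurableSet E volume) {δ : ℝ} (hδ0 : 0 < δ) (hδ1 : δ < 1) (hQ : IsCube Q)
    (hlt : ENNReal.ofReal δ * volume Q < volume (E ∩ Q)) :
    ENNReal.ofReal (δ / 6 ^ d * Real.log δ⁻¹) * volume Q ≤ ∫⁻ y in Q, ‖cutoffMaximal E δ y‖ₑ := by
  have hlayer : ∫⁻ y in Q, ‖cutoffMaximal E δ y‖ₑ =
      ∫⁻ t in Ioi (0 : ℝ), volume.restrict Q {y | t < cutoffMaximal E δ y} := by
    rw [← lintegral_eq_lintegral_meas_lt _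
      (Filter.Eventually.of_forall (cutoffMaximal_nonneg E δ))
      (measurable_cutoffMaximal E δ).aemeasurable]
    refine lintegral_congr fun y => ?_
    rw [← ofReal_norm, Real.norm_of_nonneg (cutoffMaximal_nonneg E δ y)]
  -- Either `Q` lies in the level set at height `t`, or the reverse weak type inequality bounds the
  -- measure of their intersection below by `|E ∩ Q| / (6^d t)`. Integration of `1/t` then produces
  -- the logarithm.
  have hle : ∀ t ∈ Ioo δ 1, ENNReal.ofReal (δ / 6 ^ d) * (ENNReal.ofReal t⁻¹ * volume Q) ≤
      volume.restrict Q {y | t < cutoffMaximal E δ y} := fun t ht => by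
    have ht0 : 0 < t := hδ0.trans ht.1
    have hset : {y | t < cutoffMaximal E δ y} = superlevel E (ENNReal.ofReal t) := by
      ext y
      rw [mem_ofPred_eq, lt_cutoffMaximal_iff hE ht0, max_eq_left ht.1.le]
    have h6 : (1 : ℝ) ≤ 6 ^ d := one_le_pow₀ (by norm_num)
    rw [hset, Measure.restrict_apply' hQ.isOpen.measurableSet, ← mul_assoc,
      ← ENNReal.ofReal_mul (by positivity)]
    rcases subset_superlevel_or_volume_inter_le hd (E := E)
      (ENNReal.ofReal_lt_one.2 ht.2) hQ with h | h
    · rw [inter_eq_self_of_subset_right h]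
      refine mul_le_of_le_one_left' (ENNReal.ofReal_le_one.2 ?_)
      rw [← div_eq_mul_inv, div_div, div_le_one (by positivity)]
      nlinarith [ht.1]
    · have hc : (6 : ℝ≥0∞) ^ d * ENNReal.ofReal t = ENNReal.ofReal (6 ^ d * t) := by
        rw [ENNReal.ofReal_mul (by positivity), ENNReal.ofReal_pow (by norm_num),
          ENNReal.ofReal_ofNat]
      rw [hc] at h
      have h2 := hlt.le.trans h
      calc ENNReal.ofReal (δ / 6 ^ d * t⁻¹) * volume Q
          = ENNReal.ofReal (6 ^ d * t)⁻¹ * (ENNReal.ofReal δ * volume Q) := by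
            rw [← mul_assoc, ← ENNReal.ofReal_mul (by positivity)]
            congr 2
            field_simp
        _ ≤ ENNReal.ofReal (6 ^ d * t)⁻¹ * (ENNReal.ofReal (6 ^ d * t) *
              volume (superlevel E (ENNReal.ofReal t) ∩ Q)) := by gcongr
        _ = _ := by
            rw [← mul_assoc, ← ENNReal.ofReal_mul (by positivity),
              inv_mul_cancel₀ (by positivity), ENNReal.ofReal_one, one_mul]
  calc ENNReal.ofReal (δ / 6 ^ d * Real.log δ⁻¹) * volume Q
      = ∫⁻ t in Ioo δ 1, ENNReal.ofReal (δ / 6 ^ d) * (ENNReal.ofReal t⁻¹ * volume Q) := by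
        rw [lintegral_const_mul' _ _ ENNReal.ofReal_ne_top, lintegral_mul_const _ (by fun_prop),
          setLIntegral_congr Ioo_ae_eq_Ioc, lintegral_Ioc_inv hδ0 hδ1, ← mul_assoc,
          ← ENNReal.ofReal_mul (by positivity)]
    _ ≤ ∫⁻ t in Ioo δ 1, volume.restrict Q {y | t < cutoffMaximal E δ y} :=
        setLIntegral_mono' measurableSet_Ioo hle
    _ ≤ _ := by
        rw [hlayer]
        exact lintegral_mono_set fun t ht => hδ0.trans ht.1

/-- The logarithmic gain over the estimate `primitive_superlevel_le`. -/
theorem primitive_superlevel_le_log (hd : 0 < d) {K : ℝ≥0} (hp : 0 < p)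
    (hK : ∀ f : (Fin d → ℝ) → ℝ, AEMeasurable f volume → ∀ t : ℝ, 0 < t →
      ENNReal.ofReal (t ^ p) * primitive w (distribution u (maximal f) t) ≤
        K * lorentzIntegral p u w f)
    {E : Set (Fin d → ℝ)} (hE : NullMeasurableSet E volume) {δ : ℝ} (hδ0 : 0 < δ) (hδ1 : δ < 1) :
    primitive w (weightOf u (superlevel E (ENNReal.ofReal δ))) ≤
      ENNReal.ofReal (K ^ 2 * (1 + p * Real.log δ⁻¹) *
        (δ * Real.log δ⁻¹ / (2 * 6 ^ d)) ^ (-p)) * primitive w (weightOf u E) := by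
  have hL : 0 < Real.log δ⁻¹ := Real.log_pos ((one_lt_inv₀ hδ0).2 hδ1)
  -- Half the lower bound for the averages of `cutoffMaximal E δ`, so that the maximal function
  -- exceeds `t` strictly.
  set t : ℝ := δ * Real.log δ⁻¹ / (2 * 6 ^ d) with ht
  have ht0 : 0 < t := by positivity
  have h := hK _ (measurable_cutoffMaximal E δ).aemeasurable t ht0
  have hsub : superlevel E (ENNReal.ofReal δ) ⊆
      {x | ENNReal.ofReal t < ‖maximal (cutoffMaximal E δ) x‖ₑ} := by
    rintro x ⟨Q, hQ, hx, hlt⟩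
    refine lt_maximal_iff.2 ⟨Q, hQ, hx, lt_of_lt_of_le ?_
      (ofReal_mul_volume_le_lintegral_cutoffMaximal hd hE hδ0 hδ1 hQ hlt)⟩
    refine ENNReal.mul_lt_mul_left hQ.volume_ne_zero hQ.volume_ne_top ?_
    have : δ / 6 ^ d * Real.log δ⁻¹ = 2 * t := by rw [ht]; field_simp
    rw [this]
    exact (ENNReal.ofReal_lt_ofReal_iff (by positivity)).2 (by linarith)
  calc primitive w (weightOf u (superlevel E (ENNReal.ofReal δ)))
      ≤ primitive w (distribution u (maximal (cutoffMaximal E δ)) t) :=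
        primitive_mono (weightOf_mono hsub)
    _ = ENNReal.ofReal (t ^ (-p)) * (ENNReal.ofReal (t ^ p) *
          primitive w (distribution u (maximal (cutoffMaximal E δ)) t)) := by
        rw [← mul_assoc, ← ENNReal.ofReal_mul (by positivity), ← Real.rpow_add ht0]
        simp
    _ ≤ ENNReal.ofReal (t ^ (-p)) * (K * (ENNReal.ofReal (1 + p * Real.log δ⁻¹) *
          (K * primitive w (weightOf u E)))) := by
        exact mul_le_mul_right (h.trans
          (mul_le_mul_right (lorentzIntegral_cutoffMaximal_le hp hK hE hδ0 hδ1) _)) _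
    _ = _ := by
        rw [ENNReal.ofReal_mul (by positivity), ENNReal.ofReal_mul (by positivity),
          ENNReal.ofReal_pow K.coe_nonneg, ENNReal.ofReal_coe_nnreal]
        ring

/-- With `L = log(1/δ)`, the quotient of the two sides is `K (2D²)^p (L^(-p) + p L^(1-p))`. It tends
to 0 as `L → ∞` because `p > 1`. -/
theorem exists_rpow_neg_mul_lt {K D : ℝ} (hp : 1 < p) (hD : 0 < D) :
    ∃ δ : ℝ, 0 < δ ∧ δ < 1 ∧ D * δ < 1 ∧
      K * (1 + p * Real.log δ⁻¹) * (δ * Real.log δ⁻¹ / (2 * D)) ^ (-p) < (D * δ) ^ (-p) := by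
  have hlim : Filter.Tendsto (fun L : ℝ => K * (2 * D ^ 2) ^ p * (L ^ (-p) + p * L ^ (-(p - 1))))
      Filter.atTop (nhds 0) := by
    have h := ((tendsto_rpow_neg_atTop (by linarith : 0 < p)).add
      ((tendsto_rpow_neg_atTop (sub_pos.2 hp)).const_mul p)).const_mul (K * (2 * D ^ 2) ^ p)
    simpa using h
  obtain ⟨L, hL1, hL0, hLD⟩ := ((hlim.eventually_lt_const one_pos).and
    ((Filter.eventually_gt_atTop 0).and (Filter.eventually_gt_atTop (Real.log D)))).exists
  have hDδ : D * Real.exp (-L) < 1 := by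
    rw [Real.exp_neg, ← div_eq_mul_inv, div_lt_one (Real.exp_pos _)]
    exact (Real.log_lt_iff_lt_exp hD).1 hLD
  refine ⟨Real.exp (-L), Real.exp_pos _, Real.exp_lt_one_iff.2 (by linarith), hDδ, ?_⟩
  have hδ := Real.exp_pos (-L)
  set δ := Real.exp (-L) with hδdef
  have hlog : Real.log δ⁻¹ = L := by rw [hδdef, Real.exp_neg, inv_inv, Real.log_exp]
  rw [hlog]
  have h1 : (δ * L / (2 * D)) ^ (-p) = (D * δ) ^ (-p) * ((2 * D ^ 2) ^ p * L ^ (-p)) := by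
    rw [show δ * L / (2 * D) = D * δ * ((2 * D ^ 2)⁻¹ * L) by field_simp,
      Real.mul_rpow (by positivity) (by positivity), Real.mul_rpow (by positivity) hL0.le,
      Real.inv_rpow (by positivity), Real.rpow_neg (by positivity : (0 : ℝ) ≤ 2 * D ^ 2), inv_inv]
  have h2 : L ^ (-(p - 1)) = L * L ^ (-p) := by
    rw [show -(p - 1) = 1 + -p by ring, Real.rpow_add hL0, Real.rpow_one]
  rw [h2] at hL1
  have h3 : 0 < (D * δ) ^ (-p) := by positivity
  calc K * (1 + p * L) * (δ * L / (2 * D)) ^ (-p)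
      = (D * δ) ^ (-p) * (K * (2 * D ^ 2) ^ p * (L ^ (-p) + p * (L * L ^ (-p)))) := by
        rw [h1]; ring
    _ < (D * δ) ^ (-p) * 1 := by gcongr
    _ = _ := mul_one _

/-! ### Iteration to all heights and the geometric condition. -/

/-- The strict inequality leaves room to lower the exponent, by continuity of `q ↦ τ^(-q)`. -/
theorem exists_lt_rpow_neg_le {κ τ : ℝ} (hp : 0 < p) (hτ0 : 0 < τ) (hκ : κ < τ ^ (-p)) :
    ∃ q, 0 < q ∧ q < p ∧ κ ≤ τ ^ (-q) := by
  have hcont : Filter.Tendsto (fun q : ℝ => τ ^ (-q)) (nhdsWithin p (Iio p)) (nhds (τ ^ (-p))) :=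
    ((Real.continuous_const_rpow hτ0.ne').comp continuous_neg).continuousAt.tendsto.mono_left
      nhdsWithin_le_nhds
  obtain ⟨q, h1, h2, h3⟩ := ((hcont.eventually_const_lt hκ).and
    ((eventually_nhdsWithin_of_eventually_nhds (eventually_gt_nhds hp)).and
      self_mem_nhdsWithin)).exists
  exact ⟨q, h2, h3, h1.le⟩

/-- The heights are normalised by `6^d` to absorb the constant of `superlevel_mul_subset`: `6^d (τ^m
/ 6^d)(τ / 6^d) = τ^(m+1) / 6^d`. -/
theorem primitive_superlevel_pow_le (hd : 0 < d) {τ κ : ℝ} (hτ0 : 0 < τ) (hτ1 : τ < 1)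
    (hκ : ∀ E : Set (Fin d → ℝ), NullMeasurableSet E volume →
      primitive w (weightOf u (superlevel E (ENNReal.ofReal (τ / 6 ^ d)))) ≤
        ENNReal.ofReal κ * primitive w (weightOf u E))
    (n : ℕ) {E : Set (Fin d → ℝ)} (hE : NullMeasurableSet E volume) :
    primitive w (weightOf u (superlevel E (ENNReal.ofReal (τ ^ (n + 1) / 6 ^ d)))) ≤
      ENNReal.ofReal κ ^ (n + 1) * primitive w (weightOf u E) := by
  have h6 : (1 : ℝ) ≤ 6 ^ d := one_le_pow₀ (by norm_num)
  have hlt : ∀ m : ℕ, ENNReal.ofReal (τ ^ (m + 1) / 6 ^ d) < 1 := fun m => by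
    rw [ENNReal.ofReal_lt_one, div_lt_one (by positivity)]
    exact (pow_lt_one₀ hτ0.le hτ1 m.succ_ne_zero).trans_le h6
  induction n with
  | zero => simpa using hκ E hE
  | succ n ih =>
    have hs : ENNReal.ofReal (τ ^ (n + 1 + 1) / 6 ^ d) =
        6 ^ d * ENNReal.ofReal (τ ^ (n + 1) / 6 ^ d) * ENNReal.ofReal (τ ^ (0 + 1) / 6 ^ d) := by
      rw [← ENNReal.ofReal_ofNat, ← ENNReal.ofReal_pow (by norm_num),
        ← ENNReal.ofReal_mul (by positivity), ← ENNReal.ofReal_mul (by positivity)]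
      congr 1
      field_simp
      ring
    rw [hs]
    refine (primitive_mono (weightOf_mono (superlevel_mul_subset hd E (hlt n) (hlt 0)))).trans ?_
    rw [zero_add, pow_one]
    refine (hκ _ (isOpen_superlevel E _).measurableSet.nullMeasurableSet).trans ?_
    rw [pow_succ' _ (n + 1), mul_assoc]
    gcongr

theorem WeakTypeBounded.exists_primitive_superlevel_le (hd : 0 < d) (hp : 1 < p)
    (h : WeakTypeBounded p u w) :
    ∃ q, 0 < q ∧ q < p ∧ ∃ C : ℝ, 0 < C ∧ ∀ s : ℝ, 0 < s → s ≤ 1 →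
      ∀ E : Set (Fin d → ℝ), NullMeasurableSet E volume →
        primitive w (weightOf u (superlevel E (ENNReal.ofReal s))) ≤
          ENNReal.ofReal (C * s ^ (-q)) * primitive w (weightOf u E) := by
  have hp0 : 0 < p := one_pos.trans hp
  obtain ⟨K, hK⟩ := h.exists_primitive_maximal_le hp0
  obtain ⟨δ, hδ0, hδ1, hDδ, hlt⟩ :=
    exists_rpow_neg_mul_lt (K := (K : ℝ) ^ 2) (D := 6 ^ d) hp (by positivity)
  set τ : ℝ := 6 ^ d * δ with hτ
  have hτ0 : 0 < τ := by positivity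
  obtain ⟨q, hq0, hqp, hq⟩ := exists_lt_rpow_neg_le hp0 hτ0 hlt
  have h6 : (1 : ℝ) ≤ 6 ^ d := one_le_pow₀ (by norm_num)
  have hτδ : τ / 6 ^ d = δ := by rw [hτ]; field_simp
  refine ⟨q, hq0, hqp, τ ^ (-q), by positivity, fun s hs0 hs1 E hE => ?_⟩
  -- Here `τ^(n+1) < s ≤ τ^n`. The `n + 1` iterations cost `τ^(-q) (τ^n)^(-q) ≤ τ^(-q) s^(-q)`,
  -- whence the constant `τ^(-q)`.
  obtain ⟨n, hn1, hn2⟩ := exists_nat_pow_near_of_lt_one hs0 hs1 hτ0 hDδ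
  have hiter := primitive_superlevel_pow_le (u := u) (w := w) hd hτ0 hDδ (κ := τ ^ (-q))
    (fun E hE => by
      rw [hτδ]
      refine (primitive_superlevel_le_log hd hp0 hK hE hδ0 hδ1).trans ?_
      gcongr) n hE
  refine (primitive_mono (weightOf_mono (superlevel_anti E (ENNReal.ofReal_le_ofReal ?_)))).trans
    (hiter.trans ?_)
  · exact (div_le_self (by positivity) h6).trans hn1.le
  · gcongr
    rw [← ENNReal.ofReal_pow (by positivity)]
    refine ENNReal.ofReal_le_ofReal ?_
    rw [pow_succ']
    refine mul_le_mul_of_nonneg_left ?_ (by positivity)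
    rw [← Real.rpow_mul_natCast hτ0.le, mul_comm, Real.rpow_natCast_mul hτ0.le]
    exact Real.rpow_le_rpow_of_nonpos hs0 hn2 (by linarith)

theorem WeakTypeBounded.geometricCondition (hd : 0 < d) (hp : 1 < p)
    (h : WeakTypeBounded p u w) : GeometricCondition p u w := by
  obtain ⟨q, hq0, hqp, C, hC0, hC⟩ := h.exists_primitive_superlevel_le hd hp
  refine ⟨q, hq0, hqp, (C * 2 ^ q).toNNReal, Real.toNNReal_pos.2 (by positivity),
    fun J Q S hQ hS hSQ => ?_⟩
  rcases isEmpty_or_nonempty (Fin J) with hJ | hJ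
  · simp [weightOf]
  obtain ⟨j₀, hj₀⟩ := Finite.exists_max fun j => volume (Q j) / volume (S j)
  set R := volume (Q j₀) / volume (S j₀) with hR
  have hRsup : R ^ q ≤ ⨆ j, (volume (Q j) / volume (S j)) ^ q :=
    le_iSup (fun j => (volume (Q j) / volume (S j)) ^ q) j₀
  have hStop : ∀ j, volume (S j) ≠ ∞ := fun j =>
    ((measure_mono (hSQ j)).trans_lt (hQ j).volume_ne_top.lt_top).ne
  -- If some `S j` is null, the right side is infinite.
  rcases eq_or_ne R ∞ with hRtop | hRtop
  · have : (⨆ j, (volume (Q j) / volume (S j)) ^ q) = ∞ := by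
      rwa [hRtop, ENNReal.top_rpow_of_pos hq0, top_le_iff] at hRsup
    rw [this, ENNReal.mul_top]
    · exact le_top
    · exact ENNReal.coe_ne_zero.2 (Real.toNNReal_pos.2 (by positivity)).ne'
  have hR1 : 1 ≤ R := by
    rw [hR, ENNReal.le_div_iff_mul_le (Or.inr (hQ j₀).volume_ne_zero) (Or.inl (hStop j₀)), one_mul]
    exact measure_mono (hSQ j₀)
  have hr1 : 1 ≤ R.toReal := by
    rw [← ENNReal.toReal_one]
    exact ENNReal.toReal_mono hRtop hR1
  have hr0 : 0 < R.toReal := one_pos.trans_le hr1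
  -- Every `Q j` has `|S j| / |Q j| ≥ 1/R`; the factor 2 gives the strict inequality that puts `Q j`
  -- inside the level set of `⋃ j, S j` at height `s`.
  set s : ℝ := (2 * R.toReal)⁻¹ with hs
  have hsR : ENNReal.ofReal s * R < 1 := by
    rw [← ENNReal.ofReal_toReal hRtop, ← ENNReal.ofReal_mul (by positivity), hs,
      ENNReal.ofReal_lt_one]
    field_simp
    norm_num
  refine ENNReal.div_le_of_le_mul ?_
  calc primitive w (weightOf u (⋃ j, Q j))
      ≤ primitive w (weightOf u (superlevel (⋃ j, S j) (ENNReal.ofReal s))) := by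
        refine primitive_mono (weightOf_mono (iUnion_subset fun j x hx => ⟨Q j, hQ j, hx, ?_⟩))
        have hj : volume (Q j) ≤ R * volume (S j) := by
          have h1 := hj₀ j
          have hS0 : volume (S j) ≠ 0 := fun h0 => by
            simp only [h0, ENNReal.div_zero (hQ j).volume_ne_zero, top_le_iff] at h1
            exact hRtop h1
          exact (ENNReal.div_le_iff_le_mul (Or.inl hS0) (Or.inl (hStop j))).1 h1
        have hS0 : volume (S j) ≠ 0 := fun h0 => by
          rw [h0, mul_zero, nonpos_iff_eq_zero] at hj
          exact (hQ j).volume_ne_zero hj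
        calc ENNReal.ofReal s * volume (Q j) ≤ ENNReal.ofReal s * (R * volume (S j)) := by gcongr
          _ = ENNReal.ofReal s * R * volume (S j) := (mul_assoc _ _ _).symm
          _ < 1 * volume (S j) := ENNReal.mul_lt_mul_left hS0 (hStop j) hsR
          _ ≤ volume ((⋃ j, S j) ∩ Q j) := by
            rw [one_mul]
            exact measure_mono (subset_inter (subset_iUnion S j) (hSQ j))
    _ ≤ ENNReal.ofReal (C * s ^ (-q)) * primitive w (weightOf u (⋃ j, S j)) :=
        hC s (by positivity) (inv_le_one_of_one_le₀ (by linarith)) _ (NullMeasurableSet.iUnion hS)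
    _ = (C * 2 ^ q).toNNReal * R ^ q * primitive w (weightOf u (⋃ j, S j)) := by
        congr 1
        rw [hs, Real.inv_rpow (by positivity), ← Real.rpow_neg (by positivity), neg_neg,
          Real.mul_rpow zero_le_two hr0.le, ← mul_assoc, ENNReal.ofReal_mul (by positivity),
          ← ENNReal.ofReal_rpow_of_pos hr0, ENNReal.ofReal_toReal hRtop]
        rfl
    _ ≤ _ := by gcongr

end WeightedLorentz

end

theorem theorem2 {d : ℕ} (hd : 0 < d) {p : ℝ} (hp : 1 < p)
    {u : (Fin d → ℝ) → ℝ} (hu : WeightedLorentz.IsWeight u)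
    {w : ℝ → ℝ} (hw : WeightedLorentz.IsHalfLineWeight w) (hΔ : WeightedLorentz.DeltaTwo w) :
    (WeightedLorentz.WeakTypeBounded p u w ↔ WeightedLorentz.GeometricCondition p u w) ∧
      (WeightedLorentz.WeakTypeBounded p u w ↔ WeightedLorentz.StrongTypeBounded p u w) := by
  have hp0 : 0 < p := one_pos.trans hp
  exact ⟨⟨fun h => h.geometricCondition hd hp,
      fun h => (h.strongTypeBounded hp0 hΔ).weakTypeBounded hp0⟩,
    ⟨fun h => (h.geometricCondition hd hp).strongTypeBounded hp0 hΔ,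
      fun h => h.weakTypeBounded hp0⟩⟩
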